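/- Let $\mathbb N^\times$ be the multiplicative monoid of positive integers, regarded as a category with one object $*$, and let $\widehat{\mathbb N^\times}$ be the topos of presheaves of sets on it. A point $p$ of $\widehat{\mathbb N^\times}$ is a geometric morphism $\mathrm{Set}\to\widehat{\mathbb N^\times}$, i.e. a left exact functor $p^*:\widehat{\mathbb N^\times}\to\mathrm{Set}$ together with a right adjoint $p_*$; a morphism of points $p\to q$ is a natural transformation $p^*\to q^*$. Let $L_{Pt}$ be the one-sorted language with a unary function symbol $F_n$ for each positive integer $n$ and no other symbols. A functor $A:\mathbb N^\times\to\mathrm{Set}$ is regarded as the $L_{Pt}$-structure with underlying set $A(*)$ in which $F_n$ is $A(n)$, and a point $p$ is regarded as the $L_{Pt}$-structure of the functor $p^*\circ y$, where $y:\mathbb N^\times\to\widehat{\mathbb N^\times}$ is the Yoneda embedding. A functor $A:\mathbb N^\times\to\mathrm{Set}$ with $X=A(*)$, $A(n)(x)=nx$, is flat if (i) $X\neq\emptyset$; (ii) for all $y,z\in X$ there are $m,n\ge 1$ and $w\in X$ with $mw=y$ and $nw=z$; (iii) whenever $my=ny$ with $y\in X$, there are $p\ge 1$ and $z\in X$ with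 $mp=np$ and $pz=y$. Theorem. The class of points of $\widehat{\mathbb N^\times}$ is geometric over the language $L_{Pt}$. Precisely, let $T$ be the geometric theory over $L_{Pt}$ (a set of sequents between formulas built from atomic ones by finite conjunctions, set-indexed disjunctions and existential quantifiers) with the axioms, for all $m,n\ge 1$, $$\top\vdash_x F_1(x)=x,\qquad \top\vdash_x F_m(F_n(x))=F_{mn}(x),\qquad \top\vdash \exists x\,\top,$$ $$\top\vdash_{y,z}\bigvee_{k,l\ge1}\exists w\,\bigl(F_k(w)=y\wedge F_l(w)=z\bigr),\qquad F_m(y)=F_n(y)\vdash_{y}\bigvee_{p\ge 1,\ mp=np}\exists z\;F_p(z)=y .$$ Then: 1. an $L_{Pt}$-structure is a model of $T$ if and only if it is isomorphic to the structure of a flat functor $\mathbb N^\times\to\mathrm{Set}$; 2. an $L_{Pt}$-structure is a model of $T$ if and only if it is isomorphic to the structure of a point of $\widehat{\mathbb N^\times}$; 3. the functor sending a point to its $L_{Pt}$-structure is an equivalence from the category of points of $\widehat{\mathbb N^\times}$ to the category of models of $T$ in $\mathrm{Set}$ and all their homomorphisms. -/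

import Mathlib

open CategoryTheory FirstOrder

/-! ### Geometric logic -/

namespace FirstOrder.Language

/-- Geometric formulas of a one-sorted language in the context of `n` free variables: they are built
from atomic formulas by finite conjunctions (`⊤` and binary `∧`), set-indexed disjunctions and
existential quantification. In `ex φ` the bound variable is the last one of `φ`. -/
inductive GeometricFormula (L : Language.{0, 0}) : ℕ → Type 1
  | equal {n : ℕ} (s t : L.Term (Fin n)) : GeometricFormula L n
  | rel {n k : ℕ} (R : L.Relations k) (ts : Fin k → L.Term (Fin n)) : GeometricFormula L n
  | top {n : ℕ} : GeometricFormula L n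
  | and {n : ℕ} (φ ψ : GeometricFormula L n) : GeometricFormula L n
  | or {n : ℕ} {ι : Type} (φ : ι → GeometricFormula L n) : GeometricFormula L n
  | ex {n : ℕ} (φ : GeometricFormula L (n + 1)) : GeometricFormula L n

/-- Satisfaction of a geometric formula in a structure, under an assignment of its variables. -/
def GeometricFormula.Realize {L : Language.{0, 0}} {M : Type} [L.Structure M] :
    {n : ℕ} → L.GeometricFormula n → (Fin n → M) → Prop
  | _, .equal s t, v => s.realize v = t.realize v
  | _, .rel R ts, v => Structure.RelMap R (fun i => (ts i).realize v)
  | _, .top, _ => True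
  | _, .and φ ψ, v => φ.Realize v ∧ ψ.Realize v
  | _, .or φ, v => ∃ i, (φ i).Realize v
  | n, .ex φ, v => ∃ x : M, φ.Realize (Fin.snoc v x : Fin (n + 1) → M)

/-- A geometric sequent `hyp ⊢ concl` in the context of `n` variables. -/
structure GeometricSequent (L : Language.{0, 0}) where
  /-- the number of variables of the context -/
  n : ℕ
  /-- the formula on the left -/
  hyp : L.GeometricFormula n
  /-- the formula on the right -/
  concl : L.GeometricFormula n

/-- A sequent holds in `M` if every assignment that satisfies `hyp` satisfies `concl`. -/
def GeometricSequent.Holds {L : Language.{0, 0}} (σ : L.GeometricSequent) (M : Type)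
    [L.Structure M] : Prop :=
  ∀ v : Fin σ.n → M, σ.hyp.Realize v → σ.concl.Realize v

/-- A geometric theory is a (small) family of geometric sequents, its axioms. -/
structure GeometricTheory (L : Language.{0, 0}) where
  /-- the set that labels the axioms -/
  Index : Type
  /-- the axioms -/
  axioms_ : Index → L.GeometricSequent

/-- The category of `L`-structures (possibly empty) and their homomorphisms. -/
instance structureCategory (L : Language.{0, 0}) : Category (Bundled.{0} L.Structure) where
  Hom M N := M →[L] N
  id M := Hom.id L M
  comp f g := g.comp f

/-- The models in `Set` of a geometric theory, as a property of `L`-structures. Full subcategories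
being formed with all homomorphisms, `T.Models.FullSubcategory` is the category of models. -/
def GeometricTheory.Models {L : Language.{0, 0}} (T : L.GeometricTheory) :
    ObjectProperty (Bundled.{0} L.Structure) :=
  fun M => ∀ i, (T.axioms_ i).Holds M

end FirstOrder.Language

/-! ### Points of the topos -/

/-- A geometric morphism `E ⟶ F`: a left exact functor `F ⥤ E` (the inverse image) with a right
adjoint `E ⥤ F` (the direct image). -/
structure GeometricMorphism (E : Type*) [Category E] (F : Type*) [Category F] where
  /-- the inverse image functor -/
  inverseImage : F ⥤ E
  /-- the direct image functor -/
  directImage : E ⥤ F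
  /-- the adjunction -/
  adj : inverseImage ⊣ directImage
  /-- the inverse image functor is left exact -/
  leftExact : Limits.PreservesFiniteLimits inverseImage

/-- Morphisms of geometric morphisms are the natural transformations of inverse images. -/
instance GeometricMorphism.category (E : Type*) [Category E] (F : Type*) [Category F] :
    Category (GeometricMorphism E F) where
  Hom p q := p.inverseImage ⟶ q.inverseImage
  id p := 𝟙 p.inverseImage
  comp f g := NatTrans.vcomp f g

/-- The multiplicative monoid of positive integers, as a category with one object. -/
abbrev NTimes : Type := SingleObj ℕ+

/-- The topos of presheaves of sets on the multiplicative monoid of positive integers. -/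
abbrev NTimesHat : Type 1 := NTimesᵒᵖ ⥤ Type

/-- The category of points of the topos. -/
abbrev NTimesPt : Type 1 := GeometricMorphism Type NTimesHat

/-! ### Actions as structures -/

/-- The map `A(n)` on the set `A(*)` of a functor `A` from the monoid to sets. -/
abbrev CategoryTheory.Functor.act (A : NTimes ⥤ Type) (n : ℕ+)
    (y : A.obj (SingleObj.star ℕ+)) : A.obj (SingleObj.star ℕ+) :=
  A.map (X := SingleObj.star ℕ+) (Y := SingleObj.star ℕ+) n y

/-- The function symbols of the language of actions: a unary symbol for every positive integer. -/
inductive PtFunctions : ℕ → Type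
  | F (n : ℕ+) : PtFunctions 1

/-- The language with one sort, unary function symbols `F n` for the positive integers `n`, and no
relation symbols. -/
abbrev LPt : FirstOrder.Language.{0, 0} where
  Functions := PtFunctions
  Relations := fun _ => Empty

/-- The `LPt`-structure of an action, i.e. of a functor `A` from the monoid to sets: on the set
`A(*)`, the symbol `F n` is interpreted as `A(n)`. -/
instance CategoryTheory.Functor.ptStructure (A : NTimes ⥤ Type) :
    LPt.Structure (A.obj (SingleObj.star ℕ+)) where
  funMap
    | PtFunctions.F n, x => A.act n (x 0)
  RelMap r := r.elim

/-- The functor that sends an action to its `LPt`-structure, and an equivariant map to itself. -/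
def actionStructure : (NTimes ⥤ Type) ⥤ Bundled.{0} LPt.Structure where
  obj A := ⟨A.obj (SingleObj.star ℕ+), A.ptStructure⟩
  map {A B} η := show A.obj (SingleObj.star ℕ+) →[LPt] B.obj (SingleObj.star ℕ+) from
    { toFun := fun x => η.app (SingleObj.star ℕ+) x
      map_fun' := by
        rintro _ ⟨n⟩ x
        exact NatTrans.naturality_apply η (X := SingleObj.star ℕ+) (Y := SingleObj.star ℕ+) n (x 0)
      map_rel' := fun r => r.elim }

/-- The action of a point `p`: the composite of the Yoneda embedding with the inverse image functor.
Its set is `p^*(y(*))`, on which `n` acts by `p^*(y(n))`. -/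
def pointAction : NTimesPt ⥤ (NTimes ⥤ Type) where
  obj p := yoneda ⋙ p.inverseImage
  map f := Functor.whiskerLeft yoneda f

/-- The `LPt`-structure of a point. -/
def pointStructure : NTimesPt ⥤ Bundled.{0} LPt.Structure :=
  pointAction ⋙ actionStructure

/-- Flat actions of the multiplicative monoid of positive integers. -/
structure IsFlatAction (A : NTimes ⥤ Type) : Prop where
  nonempty : Nonempty (A.obj (SingleObj.star ℕ+))
  directed : ∀ y z : A.obj (SingleObj.star ℕ+), ∃ (m n : ℕ+) (w : A.obj (SingleObj.star ℕ+)),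
    A.act m w = y ∧ A.act n w = z
  equalizing : ∀ (m n : ℕ+) (y : A.obj (SingleObj.star ℕ+)),
    A.act m y = A.act n y →
    ∃ (p : ℕ+) (z : A.obj (SingleObj.star ℕ+)), m * p = n * p ∧
      A.act p z = y

/-! ### The theory of flat actions -/

/-- The term `F n t`. -/
abbrev LPt.ap {k : ℕ} (n : ℕ+) (t : LPt.Term (Fin k)) : LPt.Term (Fin k) :=
  FirstOrder.Language.Term.func (L := LPt) (l := 1) (PtFunctions.F n) (fun _ => t)

/-- The variable number `i`. -/
abbrev LPt.x {k : ℕ} (i : Fin k) : LPt.Term (Fin k) := FirstOrder.Language.Term.var i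

/-- Labels of the axioms of the theory of flat actions. -/
inductive FlatAxiom : Type
  | one
  | mul (m n : ℕ+)
  | nonempty
  | directed
  | equalizing (m n : ℕ+)

open FirstOrder.Language.GeometricFormula in
/-- The geometric theory of flat actions:
* `⊤ ⊢ F 1 x = x`;
* `⊤ ⊢ F m (F n x) = F (m * n) x`, for all `m`, `n`;
* `⊤ ⊢ ∃ x, ⊤`, in the empty context;
* `⊤ ⊢ ⋁ m n, ∃ w, F m w = y ∧ F n w = z`;
* `F m y = F n y ⊢ ⋁ p with m * p = n * p, ∃ z, F p z = y`, for all `m`, `n`. -/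
def flatTheory : LPt.GeometricTheory where
  Index := FlatAxiom
  axioms_
    | .one => ⟨1, top, equal (LPt.ap 1 (LPt.x 0)) (LPt.x 0)⟩
    | .mul m n => ⟨1, top, equal (LPt.ap m (LPt.ap n (LPt.x 0))) (LPt.ap (m * n) (LPt.x 0))⟩
    | .nonempty => ⟨0, top, ex top⟩
    | .directed => ⟨2, top, or fun mn : ℕ+ × ℕ+ =>
        ex (and (equal (LPt.ap mn.1 (LPt.x 2)) (LPt.x 0)) (equal (LPt.ap mn.2 (LPt.x 2)) (LPt.x 1)))⟩
    | .equalizing m n => ⟨1, equal (LPt.ap m (LPt.x 0)) (LPt.ap n (LPt.x 0)),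
        or fun p : {p : ℕ+ // m * p = n * p} => ex (equal (LPt.ap p.1 (LPt.x 1)) (LPt.x 0))⟩

open CategoryTheory Limits Opposite FirstOrder

/-! ### Invariance of geometric formulas under isomorphism -/

namespace FirstOrder.Language

variable {L : Language.{0, 0}}

/-! The axioms of `flatTheory` spell out the action laws and flatness, and homomorphisms of
structures of actions are natural transformations. It remains to compare points with flat actions
(Diaconescu's theorem for this monoid).

Every presheaf is a colimit of representables, and an inverse image preserves colimits. So natural
transformations between inverse images are determined by their restrictions to representables, and
every transformation given there extends: `pointAction` is fully faithful. Left exactness makes its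
values flat (`isFlatAction_pointAction`). Conversely, flatness of `A` says that its category of
elements is cofiltered. The fiber functor is then a filtered colimit of evaluations, hence left
exact; its right adjoint is the skyscraper functor, and its restriction to representables is `A`. -/

/-- Both directions are needed for sequents: the hypothesis is pulled back and the conclusion pushed
forward. -/
theorem GeometricFormula.realize_equiv {M N : Type} [L.Structure M] [L.Structure N] (e : M ≃[L] N)
    {n : ℕ} (φ : L.GeometricFormula n) (v : Fin n → M) :
    φ.Realize (e ∘ v) ↔ φ.Realize v := by
  induction φ with
  | equal s t =>
    simp only [GeometricFormula.Realize, HomClass.realize_term]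
    exact e.injective.eq_iff
  | rel R ts =>
    simp only [GeometricFormula.Realize, HomClass.realize_term]
    exact StrongHomClass.map_rel e R fun i => (ts i).realize v
  | top => rfl
  | and φ ψ ihφ ihψ => exact and_congr (ihφ v) (ihψ v)
  | or φ ih => exact exists_congr fun i => ih i v
  | ex φ ih =>
    simp only [GeometricFormula.Realize]
    rw [← e.toEquiv.exists_congr_right]
    refine exists_congr fun x => ?_
    rw [← ih, Fin.comp_snoc]
    rfl

theorem GeometricSequent.Holds.of_equiv {M N : Type} [L.Structure M] [L.Structure N]
    {σ : L.GeometricSequent} (h : σ.Holds M) (e : M ≃[L] N) : σ.Holds N := by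
  intro v hv
  rw [← GeometricFormula.realize_equiv e.symm] at hv ⊢
  exact h _ hv

/-- An isomorphism in the category of structures, as an equivalence of structures. -/
def equivOfIso {M N : Bundled.{0} L.Structure} (i : M ≅ N) : M ≃[L] N where
  toFun := (show M →[L] N from i.hom)
  invFun := (show N →[L] M from i.inv)
  left_inv x := DFunLike.congr_fun (show (show N →[L] M from i.inv).comp
    (show M →[L] N from i.hom) = Hom.id L M from i.hom_inv_id) x
  right_inv x := DFunLike.congr_fun (show (show M →[L] N from i.hom).comp
    (show N →[L] M from i.inv) = Hom.id L N from i.inv_hom_id) x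
  map_fun' f x := (show M →[L] N from i.hom).map_fun f x
  map_rel' r x := by
    refine ⟨fun h => ?_, fun h => (show M →[L] N from i.hom).map_rel r x h⟩
    have h' := (show N →[L] M from i.inv).map_rel r _ h
    convert h' using 1
    funext j
    exact (DFunLike.congr_fun (show (show N →[L] M from i.inv).comp
      (show M →[L] N from i.hom) = Hom.id L M from i.hom_inv_id) (x j)).symm

theorem GeometricTheory.Models.of_iso {T : L.GeometricTheory} {M N : Bundled.{0} L.Structure}
    (h : T.Models M) (i : M ≅ N) : T.Models N :=
  fun a => (h a).of_equiv (equivOfIso i)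

end FirstOrder.Language

/-! ### Actions and models -/

theorem CategoryTheory.Functor.act_one (A : NTimes ⥤ Type) (x : A.obj (SingleObj.star ℕ+)) :
    A.act 1 x = x :=
  ConcreteCategory.congr_hom (A.map_id (SingleObj.star ℕ+)) x

theorem CategoryTheory.Functor.act_act (A : NTimes ⥤ Type) (m n : ℕ+)
    (x : A.obj (SingleObj.star ℕ+)) : A.act m (A.act n x) = A.act (m * n) x :=
  (ConcreteCategory.congr_hom (A.map_comp (X := SingleObj.star ℕ+) (Y := SingleObj.star ℕ+)
    (Z := SingleObj.star ℕ+) n m) x).symm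

theorem flatTheory_models_actionStructure_iff (A : NTimes ⥤ Type) :
    flatTheory.Models (actionStructure.obj A) ↔ IsFlatAction A := by
  constructor
  · intro h
    refine ⟨?_, fun y z => ?_, fun m n y hy => ?_⟩
    · obtain ⟨x, -⟩ := h .nonempty Fin.elim0 trivial
      exact ⟨x⟩
    · obtain ⟨⟨m, n⟩, w, h₁, h₂⟩ := h .directed ![y, z] trivial
      exact ⟨m, n, w, h₁, h₂⟩
    · obtain ⟨⟨p, hp⟩, z, hz⟩ := h (.equalizing m n) ![y] hy
      exact ⟨p, z, hp, hz⟩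
  · intro h a
    cases a with
    | one => exact fun v _ => A.act_one (v (0 : Fin 1))
    | mul m n => exact fun v _ => A.act_act m n (v (0 : Fin 1))
    | nonempty => exact fun v _ => ⟨h.nonempty.some, trivial⟩
    | directed =>
      intro v _
      obtain ⟨m, n, w, h₁, h₂⟩ := h.directed (v (0 : Fin 2)) (v (1 : Fin 2))
      exact ⟨(m, n), w, h₁, h₂⟩
    | equalizing m n =>
      intro v hv
      obtain ⟨p, z, hp, hz⟩ := h.equalizing m n (v (0 : Fin 1)) hv
      exact ⟨⟨p, hp⟩, z, hz⟩

/-- The action on the underlying set of a model of the theory of flat actions. -/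
def actionOfModel (M : Bundled.{0} LPt.Structure) (h : flatTheory.Models M) : NTimes ⥤ Type where
  obj _ := M
  map n := ↾fun x => Language.Structure.funMap (L := LPt) (PtFunctions.F n) fun _ => x
  map_id _ := by
    ext x
    exact h .one (fun _ => x) trivial
  -- In `SingleObj`, `n ≫ m` is `m * n`, which is the order of the `mul` axiom.
  map_comp n m := by
    ext x
    exact (h (.mul m n) (fun _ => x) trivial).symm

/-- The structure of the action of a model is the model. -/
def actionStructureOfModelIso (M : Bundled.{0} LPt.Structure) (h : flatTheory.Models M) :
    actionStructure.obj (actionOfModel M h) ≅ M where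
  hom := @Language.Hom.mk LPt M M (actionOfModel M h).ptStructure M.str id
    (by
      rintro _ ⟨n⟩ x
      exact congrArg (Language.Structure.funMap (L := LPt) (M := M) (PtFunctions.F n))
        (funext fun i => congrArg x (Subsingleton.elim 0 i)))
    (fun r => r.elim)
  inv := @Language.Hom.mk LPt M M M.str (actionOfModel M h).ptStructure id
    (by
      rintro _ ⟨n⟩ x
      exact congrArg (Language.Structure.funMap (L := LPt) (M := M) (PtFunctions.F n))
        (funext fun i => congrArg x (Subsingleton.elim i 0)))
    (fun r => r.elim)
  hom_inv_id := rfl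
  inv_hom_id := rfl

theorem isFlatAction_actionOfModel (M : Bundled.{0} LPt.Structure) (h : flatTheory.Models M) :
    IsFlatAction (actionOfModel M h) :=
  (flatTheory_models_actionStructure_iff _).1 (h.of_iso (actionStructureOfModelIso M h).symm)

/-- Homomorphisms between the structures of actions are the equivariant maps. -/
def actionStructureFullyFaithful : actionStructure.FullyFaithful where
  preimage {A B} f :=
    { app := fun _ => ↾(show A.obj (SingleObj.star ℕ+) →[LPt] B.obj (SingleObj.star ℕ+) from f)
      naturality := fun _ _ n => by
        ext x
        exact (show A.obj (SingleObj.star ℕ+) →[LPt] B.obj (SingleObj.star ℕ+) from f).map_fun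
          (PtFunctions.F n) (fun _ => x) }
  map_preimage _ := rfl
  preimage_map _ := rfl

instance : actionStructure.Full := actionStructureFullyFaithful.full

instance : actionStructure.Faithful := actionStructureFullyFaithful.faithful

/-! ### Functors on presheaves that preserve colimits -/

section Presheaf

variable {C : Type} [SmallCategory C] (F G : (Cᵒᵖ ⥤ Type) ⥤ Type)

/-- `F.obj P` is the colimit of the values of `F` on the representables over `P`, and an element of
a colimit of sets comes from some stage. -/
theorem exists_map_yoneda_eq [PreservesColimitsOfSize.{0, 0} F] {P : Cᵒᵖ ⥤ Type} (a : F.obj P) :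
    ∃ (X : C) (u : yoneda.obj X ⟶ P) (w : F.obj (yoneda.obj X)), F.map u w = a := by
  obtain ⟨j, w, h⟩ := Types.jointly_surjective_of_isColimit
    (isColimitOfPreserves F (Presheaf.isColimitTautologicalCocone P)) a
  exact ⟨j.left, j.hom, w, h⟩

variable {F G}

theorem natTrans_ext_of_yoneda [PreservesColimitsOfSize.{0, 0} F] {f g : F ⟶ G}
    (h : Functor.whiskerLeft yoneda f = Functor.whiskerLeft yoneda g) : f = g := by
  ext P a
  obtain ⟨X, u, w, rfl⟩ := exists_map_yoneda_eq F a
  have hX : f.app (yoneda.obj X) = g.app (yoneda.obj X) := NatTrans.congr_app h X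
  exact (NatTrans.naturality_apply f u w).trans
    ((congrArg (G.map u) (ConcreteCategory.congr_hom hX w)).trans
      (NatTrans.naturality_apply g u w).symm)

/-- The component at `P` comes from the universal property of `F.obj P` as a colimit over the
representables above `P`; only `F` has to preserve colimits. -/
theorem exists_whiskerLeft_yoneda_eq [PreservesColimitsOfSize.{0, 0} F]
    (f : yoneda ⋙ F ⟶ yoneda ⋙ G) : ∃ g : F ⟶ G, Functor.whiskerLeft yoneda g = f := by
  have key (P : Cᵒᵖ ⥤ Type) : ∃ d : F.obj P ⟶ G.obj P, ∀ (X : C) (u : yoneda.obj X ⟶ P),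
      F.map u ≫ d = f.app X ≫ G.map u := by
    let s : Cocone ((CostructuredArrow.proj yoneda P ⋙ yoneda) ⋙ F) :=
      { pt := G.obj P
        ι := { app := fun j => f.app j.left ≫ G.map j.hom
               naturality := fun i j k => by
                have h : F.map (yoneda.map k.left) ≫ f.app j.left =
                  f.app i.left ≫ G.map (yoneda.map k.left) := f.naturality k.left
                have hw : yoneda.map k.left ≫ j.hom = i.hom := CostructuredArrow.w k
                change F.map (yoneda.map k.left) ≫ f.app j.left ≫ G.map j.hom =
                  (f.app i.left ≫ G.map i.hom) ≫ 𝟙 _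
                rw [← Category.assoc, h, Category.comp_id, ← hw, G.map_comp]
                exact Category.assoc _ _ _ } }
    exact ⟨(isColimitOfPreserves F (Presheaf.isColimitTautologicalCocone P)).desc s, fun X u =>
      (isColimitOfPreserves F (Presheaf.isColimitTautologicalCocone P)).fac s
        (CostructuredArrow.mk u)⟩
  choose d fac using key
  refine ⟨{ app := d, naturality := fun P Q u => ?_ }, ?_⟩
  · refine (isColimitOfPreserves F (Presheaf.isColimitTautologicalCocone P)).hom_ext fun j => ?_
    change F.map j.hom ≫ F.map u ≫ d Q = F.map j.hom ≫ d P ≫ G.map u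
    rw [← F.map_comp_assoc, ← Category.assoc _ (d P), fac, fac, G.map_comp]
    exact (Category.assoc _ _ _).symm
  · ext X : 2
    -- The identity of the representable recovers `f` from the constructed component.
    have h := fac _ X (𝟙 (yoneda.obj X))
    rw [F.map_id, G.map_id, Category.id_comp] at h
    exact h.trans (Category.comp_id _)

end Presheaf

/-! ### Points and flat actions -/

instance (p : NTimesPt) : PreservesColimitsOfSize.{0, 0} p.inverseImage :=
  p.adj.leftAdjoint_preservesColimits

instance (p : NTimesPt) : PreservesFiniteLimits p.inverseImage := p.leftExact

instance : pointAction.Faithful where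
  map_injective h := natTrans_ext_of_yoneda h

instance : pointAction.Full where
  map_surjective f := exists_whiskerLeft_yoneda_eq f

/-- The three clauses come from preservation of the terminal object, of the product `Y ⨯ Y` and of
equalizers. Each time the element of the limit is lifted to a representable. -/
theorem isFlatAction_pointAction (p : NTimesPt) : IsFlatAction (pointAction.obj p) where
  nonempty := by
    let F := p.inverseImage
    obtain ⟨X, -, w, -⟩ := exists_map_yoneda_eq F
      ((Types.isTerminalEquivUnique _ (terminalIsTerminal.isTerminalObj F (⊤_ NTimesHat))).default)
    exact ⟨w⟩
  directed y z := by
    let F := p.inverseImage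
    let Y : NTimesHat := yoneda.obj (SingleObj.star ℕ+)
    let hl := mapIsLimitOfPreservesOfIsLimit F _ _ (prodIsProd Y Y)
    let hl' := (Types.binaryProductLimitCone (F.obj Y) (F.obj Y)).isLimit
    let yz : F.obj Y × F.obj Y := (y, z)
    let a : F.obj (Y ⨯ Y) := (hl'.conePointUniqueUpToIso hl).hom yz
    have h₁ : F.map prod.fst a = y := types_congr_hom
      (hl'.conePointUniqueUpToIso_hom_comp hl ⟨WalkingPair.left⟩) yz
    have h₂ : F.map prod.snd a = z := types_congr_hom
      (hl'.conePointUniqueUpToIso_hom_comp hl ⟨WalkingPair.right⟩) yz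
    obtain ⟨⟨⟩, u, w, hw⟩ := exists_map_yoneda_eq F a
    -- Since `yoneda` is full, both coordinates of `u` are multiplications by integers.
    obtain ⟨m, hm⟩ := yoneda.map_surjective (u ≫ prod.fst)
    obtain ⟨n, hn⟩ := yoneda.map_surjective (u ≫ prod.snd)
    refine ⟨m, n, w, ?_, ?_⟩
    · change F.map (yoneda.map m) w = y
      rw [hm, F.map_comp, ← h₁, ← hw]
      rfl
    · change F.map (yoneda.map n) w = z
      rw [hn, F.map_comp, ← h₂, ← hw]
      rfl
  equalizing m n y h := by
    let F := p.inverseImage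
    let f (k : ℕ+) : (yoneda.obj (SingleObj.star ℕ+) : NTimesHat) ⟶
      yoneda.obj (SingleObj.star ℕ+) :=
        yoneda.map (X := SingleObj.star ℕ+) (Y := SingleObj.star ℕ+) k
    have hl := isLimitForkMapOfIsLimit F _ (equalizerIsEqualizer (f m) (f n))
    obtain ⟨a, ha, -⟩ := Types.unique_of_type_equalizer _ _ hl y h
    obtain ⟨⟨⟩, u, w, hw⟩ := exists_map_yoneda_eq F a
    obtain ⟨k, hk⟩ := yoneda.map_surjective (u ≫ equalizer.ι (f m) (f n))
    refine ⟨k, w, ?_, ?_⟩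
    · have hk' : yoneda.map k ≫ f m = yoneda.map k ≫ f n := by
        rw [hk, Category.assoc, Category.assoc, equalizer.condition]
      rw [← yoneda.map_comp, ← yoneda.map_comp] at hk'
      exact yoneda.map_injective hk'
    · change F.map (yoneda.map k) w = y
      rw [hk, F.map_comp, ← ha, ← hw]
      rfl

/-- An arrow from `w` to `y` in the category of elements is an integer `m` with `m w = y`, so the
clauses of flatness give those of cofilteredness. -/
theorem isCofiltered_elements_of_isFlatAction {A : NTimes ⥤ Type} (h : IsFlatAction A) :
    IsCofiltered A.Elements where
  cone_objs := by
    rintro ⟨⟨⟩, y⟩ ⟨⟨⟩, z⟩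
    obtain ⟨m, n, w, h₁, h₂⟩ := h.directed y z
    exact ⟨⟨SingleObj.star ℕ+, w⟩, ⟨m, h₁⟩, ⟨n, h₂⟩, trivial⟩
  cone_maps := by
    rintro ⟨⟨⟩, y⟩ ⟨⟨⟩, z⟩ ⟨m, hm⟩ ⟨n, hn⟩
    obtain ⟨p, w, hp, hw⟩ := h.equalizing m n y (hm.trans hn.symm)
    exact ⟨⟨SingleObj.star ℕ+, w⟩, ⟨p, hw⟩, Subtype.ext hp⟩
  nonempty := ⟨⟨SingleObj.star ℕ+, h.nonempty.some⟩⟩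

/-- A flat action, as a point of the site with the trivial topology. -/
def sitePointOfFlat (A : NTimes ⥤ Type) (h : IsFlatAction A) :
    GrothendieckTopology.Point.{0} (⊥ : GrothendieckTopology NTimes) where
  fiber := A
  isCofiltered := isCofiltered_elements_of_isFlatAction h
  initiallySmall := initiallySmall_of_essentiallySmall _
  jointly_surjective {X} R hR x := by
    -- Only the maximal sieve covers, so the identity does.
    obtain rfl := GrothendieckTopology.bot_covering.1 hR
    exact ⟨X, 𝟙 X, trivial, x, by simp⟩

/-- The point of a flat action. -/
noncomputable def pointOfFlat (A : NTimes ⥤ Type) (h : IsFlatAction A) : NTimesPt where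
  inverseImage := (sitePointOfFlat A h).presheafFiber
  directImage := (sitePointOfFlat A h).skyscraperPresheafFunctor
  adj := (sitePointOfFlat A h).skyscraperPresheafAdjunction
  leftExact := inferInstance

/-- The action of the point of a flat action is that action. -/
noncomputable def pointActionPointOfFlatIso (A : NTimes ⥤ Type) (h : IsFlatAction A) :
    pointAction.obj (pointOfFlat A h) ≅ A :=
  Functor.isoWhiskerRight shrinkYonedaIsoYoneda.symm _ ≪≫
    (sitePointOfFlat A h).shrinkYonedaCompPresheafFiberIso

theorem flatTheory_models_pointStructure (p : NTimesPt) :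
    flatTheory.Models (pointStructure.obj p) :=
  (flatTheory_models_actionStructure_iff _).2 (isFlatAction_pointAction p)

theorem exists_pointStructure_iso {M : Bundled.{0} LPt.Structure} (h : flatTheory.Models M) :
    ∃ p : NTimesPt, Nonempty (pointStructure.obj p ≅ M) :=
  ⟨pointOfFlat _ (isFlatAction_actionOfModel M h),
    ⟨actionStructure.mapIso (pointActionPointOfFlatIso _ _) ≪≫ actionStructureOfModelIso M h⟩⟩

instance : pointStructure.Full := inferInstanceAs (pointAction ⋙ actionStructure).Full

instance : pointStructure.Faithful := inferInstanceAs (pointAction ⋙ actionStructure).Faithful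

theorem mainTheorem10 :
    -- the models of the theory are exactly the flat actions
    (∀ M : Bundled.{0} LPt.Structure, flatTheory.Models M ↔
      ∃ A : NTimes ⥤ Type, IsFlatAction A ∧ Nonempty (actionStructure.obj A ≅ M)) ∧
    -- the models of the theory are exactly the structures of points
    (∀ M : Bundled.{0} LPt.Structure, flatTheory.Models M ↔
      ∃ p : NTimesPt, Nonempty (pointStructure.obj p ≅ M)) ∧
    -- the category of points is equivalent to the category of models
    ∃ h : ∀ p : NTimesPt, flatTheory.Models (pointStructure.obj p),
      (flatTheory.Models.lift pointStructure h).IsEquivalence := by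
  refine ⟨fun M => ⟨fun h => ⟨actionOfModel M h, isFlatAction_actionOfModel M h,
    ⟨actionStructureOfModelIso M h⟩⟩, ?_⟩, fun M => ⟨exists_pointStructure_iso, ?_⟩,
    flatTheory_models_pointStructure, ?_⟩
  · rintro ⟨A, hA, ⟨i⟩⟩
    exact ((flatTheory_models_actionStructure_iff A).2 hA).of_iso i
  · rintro ⟨p, ⟨i⟩⟩
    exact (flatTheory_models_pointStructure p).of_iso i
  -- The lift inherits fullness and faithfulness from `pointStructure`.
  · have : (flatTheory.Models.lift pointStructure flatTheory_models_pointStructure).EssSurj :=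
      ⟨fun M => by
        obtain ⟨p, ⟨i⟩⟩ := exists_pointStructure_iso M.property
        exact ⟨p, ⟨flatTheory.Models.isoMk i⟩⟩⟩
    exact { }
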